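/- Let $k$ be a field and $r\ge 1$ an integer. Let $\mathcal C$ be the category with five objects $A_1,A_2,B_1,B_2,B_3$ whose only non-identity morphisms are $A_1\to B_1$, $A_2\to B_2$, $A_1\to B_3$, $A_2\to B_3$ (one each). A sheaf on $\mathcal C$ is a contravariant functor on $\mathcal C$; for a morphism $A\to B$ it has a restriction map $\mathcal F(B)\to\mathcal F(A)$. Let $\mathcal O=\mathcal O_{k,r}$ be the sheaf of $k$-algebras with values $$\mathcal O(A_i)=k[x_i,1/x_i],\quad \mathcal O(B_i)=k[y_i]\quad (i=1,2),\qquad \mathcal O(B_3)=k[v,1/v],$$ and restriction maps the $k$-algebra morphisms with $y_i\mapsto 1/x_i$ for $B_i$ to $A_i$, $v\mapsto x_1^{r}$ for $B_3$ to $A_1$, and $v\mapsto x_2^{-r}$ for $B_3$ to $A_2$. For $\mathbf d=(d_1,d_2)\in\mathbb Z^2$ let $\mathcal M_{k,r,\mathbf d}$ be the sheaf of $\mathcal O$-modules with values $\mathcal M(A_i)=k[x_i,1/x_i]$, $\mathcal M(B_i)=k[y_i]$, $\mathcal M(B_3)=k[v,1/v]^{\oplus r}$ and restriction maps $$p(y_i)\mapsto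 x_i^{d_i}p(1/x_i)\ (i=1,2),\qquad (q_1,\dots,q_r)\mapsto \sum_{j=1}^r x_1^{j-1}q_j(x_1^r),\qquad (q_1,\dots,q_r)\mapsto\sum_{j=1}^r x_2^{j-1}q_j(x_2^{-r}).$$ Put $\omega=\omega_{k,r}=\mathcal M_{k,r,(r-2,\,r-2)}$. For $\mathcal O$-modules $\mathcal F,\mathcal G$ let $\mathrm{Ext}^i(\mathcal F,\mathcal G)$ be the Ext groups in the abelian ($k$-linear) category of $\mathcal O$-modules, and $H^i(\mathcal F)=\mathrm{Ext}^i(\mathcal O,\mathcal F)$. For $i=1,2$ let $\mathcal S_i=\mathrm{Sky}(B_i,k[y_i]/y_ik[y_i])$ be the sheaf of $\mathcal O$-modules with value $k[y_i]/y_ik[y_i]$ at $B_i$ and $0$ at all other objects. Then: 1. $H^1(\omega)\cong k$ as $k$-vector spaces, and likewise the cokernel of $$\omega(B_1)\oplus\omega(B_2)\oplus\omega(B_3)\to\omega(A_1)\oplus\omega(A_2),\qquad (m_1,m_2,m_3)\mapsto (m_1|_{A_1}-m_3|_{A_1},\ m_2|_{A_2}-m_3|_{A_2})$$ is isomorphic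 to $k$. 2. For every isomorphism of $k$-vector spaces $\phi\colon H^1(\omega)\to k$, the sheaves $\mathcal F=\mathcal S_1$ and $\mathcal F=\mathcal S_2$ satisfy strong duality with respect to $\omega$: for $i=0$ and $i=1$ the pairing $$H^i(\mathcal F)\times \mathrm{Ext}^{1-i}(\mathcal F,\omega)\to H^1(\omega)\xrightarrow{\ \phi\ }k$$ given by the Yoneda product followed by $\phi$ is a perfect pairing of $k$-vector spaces (each factor is mapped isomorphically onto the full linear dual of the other), and $H^i(\mathcal F)=\mathrm{Ext}^i(\mathcal F,\omega)=0$ for all $i\ge 2$. -/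

import Mathlib

open CategoryTheory Opposite

universe u

noncomputable section

namespace GraphRR

/-! ### Sheaves of modules over a sheaf of `k`-algebras

A category carries its coarsest topology, so that a sheaf is a contravariant functor. -/

section General

variable {k : Type u} [Field k] {C : Type} [SmallCategory C]

/-- The sheaf of rings underlying a sheaf of `k`-algebras. -/
abbrev ringSheaf (O : Cᵒᵖ ⥤ AlgCat.{u} k) : Cᵒᵖ ⥤ RingCat.{u} :=
  O ⋙ forget₂ (AlgCat.{u} k) RingCat.{u}

/-- The category of sheaves of `O`-modules. -/
abbrev OMod (O : Cᵒᵖ ⥤ AlgCat.{u} k) := PresheafOfModules.{u} (ringSheaf O)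

variable {O : Cᵒᵖ ⥤ AlgCat.{u} k}

/-- The values of an `O`-module, as `k`-vector spaces. -/
abbrev val (F : OMod O) (P : C) : ModuleCat.{u} k :=
  (ModuleCat.restrictScalars (algebraMap k (O.obj (op P)))).obj (F.obj (op P))

/-- The restriction maps `F(Q) → F(P)`, for `P ⟶ Q`, as `k`-linear maps. -/
def res (F : OMod O) {P Q : C} (f : P ⟶ Q) : val F Q →ₗ[k] val F P where
  toFun m := F.map f.op m
  map_add' x y := (F.map f.op).hom.map_add x y
  map_smul' c x := by
    refine (F.map_smul f.op (algebraMap k (O.obj (op Q)) c) x).trans ?_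
    exact congrArg (fun a : O.obj (op P) => (a • (F.map f.op x : F.obj (op P)) : F.obj (op P)))
      ((O.map f.op).hom.commutes c)

/-- Multiplication by a scalar `c : k`, as an endomorphism of an `O`-module. -/
def scalar (F : OMod O) (c : k) : F ⟶ F where
  app X := ModuleCat.ofHom
    { toFun := fun m => (algebraMap k (O.obj X) c) • m
      map_add' := fun x y => smul_add _ x y
      map_smul' := fun a x => by
        change (algebraMap k (O.obj X) c) • (a • x) = a • ((algebraMap k (O.obj X) c) • x)
        rw [smul_smul, smul_smul]
        exact congrArg (fun b : O.obj X => b • x) (Algebra.commutes c (show O.obj X from a)) }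
  naturality {X Y} f := by
    ext m
    exact ((res F f.unop).map_smul c m).symm

/-- The category of `O`-modules is `k`-linear. -/
def scalars (O : Cᵒᵖ ⥤ AlgCat.{u} k) : k →+* CatCenter (OMod O) where
  toFun c :=
    { app := fun F => scalar F c
      naturality := fun F G f => by
        ext X m
        exact ((f.app X).hom.map_smul (algebraMap k (O.obj X) c) m).symm }
  map_one' := by
    ext F X m
    change algebraMap k (O.obj X) 1 • m = m
    rw [map_one]; exact one_smul _ m
  map_mul' a b := by
    ext F X m
    change algebraMap k (O.obj X) (a * b) • m =
      algebraMap k (O.obj X) a • algebraMap k (O.obj X) b • m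
    rw [map_mul]; exact mul_smul _ _ m
  map_zero' := by
    ext F X m
    change algebraMap k (O.obj X) 0 • m = 0
    rw [map_zero]; exact zero_smul _ m
  map_add' a b := by
    ext F X m
    change algebraMap k (O.obj X) (a + b) • m =
      algebraMap k (O.obj X) a • m + algebraMap k (O.obj X) b • m
    rw [map_add]; exact add_smul _ _ m

instance : Linear k (OMod O) := Linear.ofRingMorphism (scalars O)

instance : HasExt.{u + 1} (OMod O) := HasExt.standard _

/-- The structure sheaf `O` as an `O`-module. -/
abbrev structureSheaf (O : Cᵒᵖ ⥤ AlgCat.{u} k) : OMod O := PresheafOfModules.unit (ringSheaf O)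

/-- `Extⁱ(F, G)` in the category of `O`-modules, a `k`-vector space. -/
abbrev ExtGroup (F G : OMod O) (i : ℕ) : Type (u + 1) := Abelian.Ext F G i

/-- The cohomology group `Hⁱ(F) = Extⁱ(O, F)`. -/
abbrev H (i : ℕ) (F : OMod O) : Type (u + 1) := ExtGroup (structureSheaf O) F i

/-- The pairing `Hⁱ(F) × Extʲ(F, ω) → H¹(ω) → k`, for `i + j = 1`, given by the Yoneda product
followed by `φ`. -/
def dualityPairing {ω : OMod O} (φ : H 1 ω →ₗ[k] k) (F : OMod O) {i j : ℕ} (h : i + j = 1) :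
    H i F →ₗ[k] ExtGroup F ω j →ₗ[k] k :=
  (Abelian.Ext.bilinearCompOfLinear k (structureSheaf O) F ω i j 1 h).compr₂ φ

/-- Strong duality for the `O`-module `F` with respect to `φ : H¹(ω) → k`. -/
structure StrongDuality {ω : OMod O} (φ : H 1 ω →ₗ[k] k) (F : OMod O) : Prop where
  perfect_zero : (dualityPairing φ F (zero_add 1)).IsPerfPair
  perfect_one : (dualityPairing φ F (add_zero 1)).IsPerfPair
  cohomology_vanishing : ∀ i : ℕ, 2 ≤ i → Subsingleton (H i F)
  ext_vanishing : ∀ i : ℕ, 2 ≤ i → Subsingleton (ExtGroup F ω i)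

/-- The skyscraper sheaf `Sky(P, M)` at `P` with value the `O(P)`-module `M`. Its value at `Q` is
`M ^ Hom(P, Q)`, where `O(Q)` acts on the factor of `φ : P ⟶ Q` through `O(Q) → O(P)`; when
Hom-sets have at most one element, this is `M` if `P ≤ Q` and `0` otherwise. -/
def sky (P : C) (M : ModuleCat.{u} ((ringSheaf O).obj (op P))) : OMod O where
  obj Q := ModuleCat.of ((ringSheaf O).obj Q)
    (∀ φ : P ⟶ Q.unop, (ModuleCat.restrictScalars ((ringSheaf O).map φ.op).hom).obj M)
  map {Q Q'} f := ModuleCat.ofHom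
    (Y := (ModuleCat.restrictScalars ((ringSheaf O).map f).hom).obj
      (ModuleCat.of ((ringSheaf O).obj Q')
        (∀ φ : P ⟶ Q'.unop, (ModuleCat.restrictScalars ((ringSheaf O).map φ.op).hom).obj M)))
    { toFun := fun s φ => s (φ ≫ f.unop)
      map_add' := fun s t => rfl
      map_smul' := fun a s => by
        funext φ
        change (ringSheaf O).map (φ ≫ f.unop).op a • (show M from s (φ ≫ f.unop)) =
          (ringSheaf O).map φ.op ((ringSheaf O).map f a) • (show M from s (φ ≫ f.unop))
        congr 1
        exact congrArg (fun g => g.hom a) ((ringSheaf O).map_comp f φ.op) }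
  map_id Q := by
    ext s
    funext φ
    exact congrArg s (Category.comp_id φ)
  map_comp f g := by
    ext s
    funext φ
    exact congrArg s (Category.assoc φ g.unop f.unop).symm

end General

/-! ### The category with five objects -/

/-- The five objects: `A i` and `B i` for `i : Fin 2` stand for `A₁, A₂, B₁, B₂`. -/
inductive C2V : Type
  | A (i : Fin 2)
  | B (i : Fin 2)
  | B₃

namespace C2V

/-- Besides identities there is exactly one morphism `A i ⟶ B i` and one `A i ⟶ B₃`. -/
inductive Hom : C2V → C2V → Type
  | id (P : C2V) : Hom P P
  | e (i : Fin 2) : Hom (A i) (B i)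
  | e₃ (i : Fin 2) : Hom (A i) B₃

/-- Composition: at least one of the two morphisms is an identity. -/
def Hom.comp : {P Q R : C2V} → Hom P Q → Hom Q R → Hom P R
  | _, _, _, .id _, g => g
  | _, _, _, .e i, .id _ => .e i
  | _, _, _, .e₃ i, .id _ => .e₃ i

instance : SmallCategory C2V where
  Hom := Hom
  id := Hom.id
  comp := Hom.comp
  id_comp _ := rfl
  comp_id f := by cases f <;> rfl
  assoc f g h := by cases f <;> cases g <;> rfl

/-- The morphism `A i ⟶ B i`. -/
def e (i : Fin 2) : A i ⟶ B i := Hom.e i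

/-- The morphism `A i ⟶ B₃`. -/
def e₃ (i : Fin 2) : A i ⟶ B₃ := Hom.e₃ i

section Sheaf

variable {D : Type*} [Category D] (obj : C2V → D) (r : ∀ i, obj (B i) ⟶ obj (A i))
  (r₃ : ∀ i, obj B₃ ⟶ obj (A i))

/-- The restriction maps of the sheaf below. -/
def sheafRes : {P Q : C2V} → Hom P Q → (obj Q ⟶ obj P)
  | _, _, .id P => 𝟙 (obj P)
  | _, _, .e i => r i
  | _, _, .e₃ i => r₃ i

theorem sheafRes_comp : ∀ {P Q R : C2V} (g : Hom P Q) (f : Hom Q R),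
    sheafRes obj r r₃ (g.comp f) = sheafRes obj r r₃ f ≫ sheafRes obj r r₃ g
  | _, _, _, .id _, _ => (Category.comp_id _).symm
  | _, _, _, .e _, .id _ => (Category.id_comp _).symm
  | _, _, _, .e₃ _, .id _ => (Category.id_comp _).symm

/-- A sheaf with values in a category `D` is given by its values and its restrictions along the
four non-identity morphisms. -/
def mkSheaf : C2Vᵒᵖ ⥤ D where
  obj P := obj P.unop
  map f := sheafRes obj r r₃ f.unop
  map_id _ := rfl
  map_comp f g := sheafRes_comp obj r r₃ g.unop f.unop

end Sheaf

variable {k : Type u} [Field k]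

section Module

variable {O : C2Vᵒᵖ ⥤ AlgCat.{u} k} (M : ∀ P : C2V, ModuleCat.{u} ((ringSheaf O).obj (op P)))
  (r : ∀ i, M (B i) →ₛₗ[((ringSheaf O).map (e i).op).hom] M (A i))
  (r₃ : ∀ i, M B₃ →ₛₗ[((ringSheaf O).map (e₃ i).op).hom] M (A i))

/-- The restriction maps of the sheaf of modules below. -/
def moduleRes : {P Q : C2V} → (f : Hom P Q) → (M Q ⟶
    (ModuleCat.restrictScalars ((ringSheaf O).map (Quiver.Hom.op (V := C2V) f)).hom).obj (M P))
  | _, _, .id P => (ModuleCat.restrictScalarsId' ((ringSheaf O).map (𝟙 (op P))).hom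
      (congrArg RingCat.Hom.hom ((ringSheaf O).map_id (op P)))).inv.app (M P)
  | _, _, .e i => ModuleCat.ofHom
      (Y := (ModuleCat.restrictScalars ((ringSheaf O).map (e i).op).hom).obj (M (A i)))
      { toFun := r i, map_add' := (r i).map_add, map_smul' := (r i).map_smulₛₗ }
  | _, _, .e₃ i => ModuleCat.ofHom
      (Y := (ModuleCat.restrictScalars ((ringSheaf O).map (e₃ i).op).hom).obj (M (A i)))
      { toFun := r₃ i, map_add' := (r₃ i).map_add, map_smul' := (r₃ i).map_smulₛₗ }

theorem moduleRes_comp : ∀ {P Q R : C2V} (g : Hom P Q) (f : Hom Q R) (m : M R),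
    (moduleRes M r r₃ (g.comp f)).hom m =
      (moduleRes M r r₃ g).hom (show M Q from (moduleRes M r r₃ f).hom m)
  | _, _, _, .id _, _, _ => rfl
  | _, _, _, .e _, .id _, _ => rfl
  | _, _, _, .e₃ _, .id _, _ => rfl

/-- A sheaf of `O`-modules is given by its values and its restrictions along the four non-identity
morphisms. -/
def mkModule : OMod O where
  obj P := M P.unop
  map f := moduleRes M r r₃ f.unop
  map_id _ := rfl
  map_comp f g := by
    ext m
    exact moduleRes_comp M r r₃ g.unop f.unop m

end Module

/-- The map `F(B₁) ⊕ F(B₂) ⊕ F(B₃) → F(A₁) ⊕ F(A₂)`, which sends `(m₁, m₂, m₃)` to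
`(m₁|A₁ - m₃|A₁, m₂|A₂ - m₃|A₂)`. -/
def coboundary {O : C2Vᵒᵖ ⥤ AlgCat.{u} k} (F : OMod O) :
    ((∀ i, val F (B i)) × val F B₃) →ₗ[k] (∀ i, val F (A i)) :=
  LinearMap.pi fun i =>
    res F (e i) ∘ₗ LinearMap.proj i ∘ₗ LinearMap.fst k (∀ i, val F (B i)) (val F B₃) -
      res F (e₃ i) ∘ₗ LinearMap.snd k (∀ i, val F (B i)) (val F B₃)

end C2V

/-! ### The sheaves `O_{k,r}` and `M_{k,r,d}` -/

section Sheaves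

open C2V Polynomial LaurentPolynomial

variable (k : Type u) [Field k] (r : ℕ) (d : Fin 2 → ℤ)

/-- The values of `O_{k,r}`: `k[x_i, 1/x_i]` at `A_i`, `k[y_i]` at `B_i`, `k[v, 1/v]` at `B₃`. -/
def OVal : C2V → AlgCat.{u} k
  | .A _ => AlgCat.of k k[T;T⁻¹]
  | .B _ => AlgCat.of k k[X]
  | .B₃ => AlgCat.of k k[T;T⁻¹]

/-- The restriction `k[y_i] → k[x_i, 1/x_i]`, `y_i ↦ 1/x_i`. -/
def resB : k[X] →ₐ[k] k[T;T⁻¹] := Polynomial.aeval (T (-1))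

/-- The exponents `r` and `-r` of `v ↦ x₁ ^ r` and `v ↦ x₂ ^ (-r)`. -/
def wind : Fin 2 → ℤ := ![(r : ℤ), -(r : ℤ)]

/-- The restriction `k[v, 1/v] → k[x_i, 1/x_i]`, `v ↦ x₁ ^ r` (`i = 1`), `v ↦ x₂ ^ (-r)`
(`i = 2`). -/
def resB₃ (i : Fin 2) : k[T;T⁻¹] →ₐ[k] k[T;T⁻¹] :=
  AddMonoidAlgebra.mapDomainAlgHom k k (AddMonoidHom.mulLeft (wind r i))

/-- The sheaf of `k`-algebras `O_{k,r}`. -/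
def sheafO : C2Vᵒᵖ ⥤ AlgCat.{u} k :=
  mkSheaf (OVal k) (fun _ => AlgCat.ofHom (resB k)) (fun i => AlgCat.ofHom (resB₃ k r i))

/-- The values of `M_{k,r,d}`: those of `O_{k,r}`, except for `k[v, 1/v] ^ r` at `B₃`. -/
def MVal : ∀ P : C2V, ModuleCat.{u} ((ringSheaf (sheafO k r)).obj (op P))
  | .A _ => ModuleCat.of k[T;T⁻¹] k[T;T⁻¹]
  | .B _ => ModuleCat.of k[X] k[X]
  | .B₃ => ModuleCat.of k[T;T⁻¹] (Fin r → k[T;T⁻¹])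

/-- The restriction `p(y_i) ↦ x_i ^ d_i p(1/x_i)` of `M_{k,r,d}`. -/
def resMB (n : ℤ) : k[X] →ₛₗ[(resB k).toRingHom] k[T;T⁻¹] where
  toFun p := T n * resB k p
  map_add' p q := by rw [map_add, mul_add]
  map_smul' a p := by
    simp only [smul_eq_mul, map_mul, AlgHom.toRingHom_eq_coe, RingHom.coe_coe]
    ring

/-- The restriction `(q_1, …, q_r) ↦ ∑ⱼ x_i ^ (j - 1) q_j(v)` of `M_{k,r,d}`, where `v` stands for
`x₁ ^ r` (`i = 1`) or `x₂ ^ (-r)` (`i = 2`); here `j` is counted from `0`. -/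
def resMB₃ (i : Fin 2) : (Fin r → k[T;T⁻¹]) →ₛₗ[(resB₃ k r i).toRingHom] k[T;T⁻¹] where
  toFun q := ∑ j : Fin r, T ((j : ℕ) : ℤ) * resB₃ k r i (q j)
  map_add' p q := by simp only [Pi.add_apply, map_add, mul_add, Finset.sum_add_distrib]
  map_smul' a q := by
    simp only [Pi.smul_apply, smul_eq_mul, map_mul, AlgHom.toRingHom_eq_coe, RingHom.coe_coe,
      Finset.mul_sum]
    exact Finset.sum_congr rfl fun j _ => by ring

/-- The sheaf of `O_{k,r}`-modules `M_{k,r,d}`. -/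
def sheafM : OMod (sheafO k r) :=
  mkModule (MVal k r) (fun i => resMB k (d i)) (fun i => resMB₃ k r i)

/-- The sheaf `ω_{k,r} = M_{k,r,K_r}`, where `K_r = (r - 2, r - 2)`. -/
def omega : OMod (sheafO k r) := sheafM k r fun _ => (r : ℤ) - 2

/-- The torsion skyscraper sheaf `Sky(B_i, k[y_i] / y_i k[y_i])`. -/
def torsionSky (i : Fin 2) : OMod (sheafO k r) :=
  sky (B i) (ModuleCat.of k[X] (k[X] ⧸ Ideal.span {(X : k[X])}))

end Sheaves

end GraphRR

end

noncomputable section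

namespace GraphRR

/-! ### Linear algebra and homological algebra -/

/-! Everything is computed from projective resolutions of length one. A morphism out of the free
module on a representable presheaf is a section over the representing object, and epimorphisms are
surjective on sections, so these modules are projective. Gluing resolves the structure sheaf by the
free modules on the `A i` and on the `B i`, `B₃`; applying `Hom(-, F)` gives `coboundary F`, so its
cokernel is `H¹(F)` and higher cohomology vanishes (`quotCoboundaryEquiv`, `subsingleton_H`).

For `ω` the cokernel is found on monomials. Sections over `B i` kill `x_i ^ m` for `m ≤ r - 2`.
Sections over `B₃` identify `x₁ ^ (j + r n)` with `-x₂ ^ (j - r n)` for `0 ≤ j < r`, so an exponent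
`m ≥ r` on one side turns into a negative one on the other and dies too. Only `x₁ ^ (r - 1)` and `x₂
^ (r - 1)` remain, equal up to sign. The difference of their coefficients vanishes on coboundaries,
so the quotient is exactly a line (`ker_residue`).

Multiplication by `y_i` on the free module on `B i` resolves the skyscraper sheaf. Hence `H⁰` is
spanned by the section `1`, `Ext¹` into `ω` by the connecting image of the section `1` of `ω` over
`B i`, and `H¹` and `Ext⁰` vanish. Lifting the section `1` to the resolutions involves `1 / y_i =
x_i` over `A i`, so the product of the two generators is the class of `x_i * x_i ^ (r - 2) = x_i ^
(r - 1)`, which is nonzero (`mk₀_torsionOne_comp_torsionExt`). A pairing of two lines that is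
nonzero on generators is perfect, whichever `φ` is used. -/

/-- A pairing of two vector spaces spanned by one vector each is perfect if it does not vanish
on these vectors. -/
theorem isPerfPair_of_span {k V W : Type*} [Field k] [AddCommGroup V] [Module k V]
    [AddCommGroup W] [Module k W] (b : V →ₗ[k] W →ₗ[k] k) {v : V} {w : W}
    (hv : ∀ x, ∃ c : k, x = c • v) (hw : ∀ y, ∃ c : k, y = c • w) (h : b v w ≠ 0) :
    b.IsPerfPair where
  bijective_left := by
    constructor
    · refine (injective_iff_map_eq_zero b).2 fun x hx => ?_
      obtain ⟨c, rfl⟩ := hv x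
      have := LinearMap.congr_fun hx w
      simp only [map_smul, LinearMap.smul_apply, LinearMap.zero_apply, smul_eq_mul,
        mul_eq_zero, h, or_false] at this
      rw [this, zero_smul]
    · intro f
      refine ⟨(f w / b v w) • v, LinearMap.ext fun y => ?_⟩
      obtain ⟨c, rfl⟩ := hw y
      simp [h]
  bijective_right := by
    constructor
    · refine (injective_iff_map_eq_zero b.flip).2 fun y hy => ?_
      obtain ⟨c, rfl⟩ := hw y
      have := LinearMap.congr_fun hy v
      simp only [map_smul, LinearMap.smul_apply, LinearMap.zero_apply, smul_eq_mul,
        mul_eq_zero, LinearMap.flip_apply, h, or_false] at this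
      rw [this, zero_smul]
    · intro f
      refine ⟨(f v / b v w) • w, LinearMap.ext fun x => ?_⟩
      obtain ⟨c, rfl⟩ := hv x
      simp [h]

/-- A pairing of two zero spaces is perfect. -/
theorem isPerfPair_of_subsingleton {k V W : Type*} [Field k] [AddCommGroup V] [Module k V]
    [AddCommGroup W] [Module k W] [Subsingleton V] [Subsingleton W] (b : V →ₗ[k] W →ₗ[k] k) :
    b.IsPerfPair where
  bijective_left := ⟨fun _ _ _ => Subsingleton.elim _ _, fun f => ⟨0, by
    ext y; rw [Subsingleton.elim y 0, map_zero, map_zero]⟩⟩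
  bijective_right := ⟨fun _ _ _ => Subsingleton.elim _ _, fun f => ⟨0, by
    ext y; rw [Subsingleton.elim y 0, map_zero, map_zero]⟩⟩

/-! ### Ext groups from a short exact sequence. -/

section Ext

open Abelian

universe w v

variable {𝒜 : Type*} [Category.{v} 𝒜] [Abelian 𝒜] [HasExt.{w} 𝒜] {S : ShortComplex 𝒜}
  (hS : S.ShortExact)

/-- The connecting map `Hom(S₁, Y) → Ext¹(S₃, Y)` of a short exact sequence. -/
def connecting (k : Type*) [CommRing k] [Linear k 𝒜] (Y : 𝒜) :
    (S.X₁ ⟶ Y) →ₗ[k] Ext S.X₃ Y 1 :=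
  hS.extClass.precompOfLinear k Y (add_zero 1) ∘ₗ (Ext.linearEquiv₀ (R := k)).symm.toLinearMap

theorem connecting_apply (k : Type*) [CommRing k] [Linear k 𝒜] {Y : 𝒜} (f : S.X₁ ⟶ Y) :
    connecting hS k Y f = hS.extClass.comp (Ext.mk₀ f) (add_zero 1) := rfl

theorem connecting_surjective (k : Type*) [CommRing k] [Linear k 𝒜] [Projective S.X₂] (Y : 𝒜) :
    Function.Surjective (connecting hS k Y) := fun x => by
  obtain ⟨y, hy⟩ := Ext.contravariant_sequence_exact₃ hS Y x
    (Ext.eq_zero_of_projective (n := 0) _) (add_zero 1)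
  obtain ⟨f, rfl⟩ := (Ext.linearEquiv₀ (R := k)).symm.surjective y
  exact ⟨f, hy⟩

theorem connecting_eq_zero_iff (k : Type*) [CommRing k] [Linear k 𝒜] {Y : 𝒜} (f : S.X₁ ⟶ Y) :
    connecting hS k Y f = 0 ↔ ∃ g : S.X₂ ⟶ Y, S.f ≫ g = f := by
  constructor
  · intro h
    obtain ⟨y, hy⟩ := Ext.contravariant_sequence_exact₁ hS Y (Ext.mk₀ f) (add_zero 1) h
    obtain ⟨g, rfl⟩ := (Ext.linearEquiv₀ (R := k)).symm.surjective y
    refine ⟨g, ?_⟩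
    have h' : (Ext.mk₀ S.f).comp (Ext.mk₀ g) (zero_add 0) = Ext.mk₀ f := hy
    rw [Ext.mk₀_comp_mk₀] at h'
    exact (Ext.linearEquiv₀ (R := k)).symm.injective h'
  · rintro ⟨g, rfl⟩
    rw [connecting_apply, ← Ext.mk₀_comp_mk₀]
    exact hS.extClass_comp_assoc _

include hS in
/-- An object with a projective resolution of length one has no higher Ext groups. -/
theorem subsingleton_ext_of_shortExact [Projective S.X₁] [Projective S.X₂] (Y : 𝒜) {n : ℕ}
    (hn : 2 ≤ n) : Subsingleton (Ext S.X₃ Y n) := by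
  obtain ⟨m, rfl⟩ := Nat.exists_eq_add_of_le hn
  refine subsingleton_of_forall_eq 0 fun x => ?_
  have e : 1 + (m + 1) = 2 + m := by omega
  -- The vanishing on projectives is stated in successor degrees, so the degree `2 + m` is
  -- generalized before it is rewritten as `m + 1 + 1`.
  have h : ∀ (n : ℕ) (_ : n = m + 1 + 1) (y : Ext S.X₂ Y n), y = 0 := by
    rintro _ rfl y; exact Ext.eq_zero_of_projective y
  obtain ⟨y, rfl⟩ := Ext.contravariant_sequence_exact₃ hS Y x (h _ (by omega) _) e
  rw [Ext.eq_zero_of_projective y, Ext.comp_zero]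

end Ext

/-! ### Representable modules -/

section Generators

variable {k : Type u} [Field k] {C : Type} [SmallCategory C] {O : Cᵒᵖ ⥤ AlgCat.{u} k}

/-- The values of a morphism of `O`-modules, as `k`-linear maps. -/
def app {F G : OMod O} (g : F ⟶ G) (P : C) : val F P →ₗ[k] val G P where
  toFun m := g.app (op P) m
  map_add' := (g.app (op P)).hom.map_add
  map_smul' c := (g.app (op P)).hom.map_smul (algebraMap k (O.obj (op P)) c)

theorem app_smul {F G : OMod O} (c : k) (f : F ⟶ G) (P : C) (m : val F P) :
    app (c • f) P m = c • app f P m :=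
  (app f P).map_smul c m

variable (O) in
/-- The free `O`-module on the presheaf represented by `P`. -/
def free (P : C) : OMod O :=
  (PresheafOfModules.free (ringSheaf O)).obj (uliftYoneda.{u}.obj P)

/-- A morphism out of `free O P` is a section over `P`. -/
def freeEquiv (P : C) (F : OMod O) : (free O P ⟶ F) ≃ₗ[k] val F P where
  __ := PresheafOfModules.freeHomEquiv.trans uliftYonedaEquiv
  map_add' _ _ := rfl
  map_smul' c f := app_smul c f _ _

theorem app_res {F G : OMod O} (g : F ⟶ G) {P Q : C} (f : P ⟶ Q) (m : val F Q) :
    app g P (res F f m) = res G f (app g Q m) :=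
  PresheafOfModules.naturality_apply g f.op m

theorem res_id {F : OMod O} {P : C} (m : val F P) : res F (𝟙 P) m = m := by
  change F.map (𝟙 (op P)) m = m
  rw [F.map_id]; rfl

theorem res_comp {F : OMod O} {P Q R : C} (f : P ⟶ Q) (g : Q ⟶ R) (m : val F R) :
    res F (f ≫ g) m = res F f (res F g m) :=
  F.map_comp_apply g.op f.op m

/-- The basis element of `free O P` over `Q` given by `φ : Q ⟶ P`. -/
def freeGen {P Q : C} (φ : Q ⟶ P) : val (free O P) Q :=
  ModuleCat.freeMk (R := (ringSheaf O).obj (op Q)) (ULift.up φ)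

theorem freeEquiv_apply {P : C} {F : OMod O} (f : free O P ⟶ F) :
    freeEquiv P F f = app f P (freeGen (𝟙 P)) := rfl

theorem app_freeEquiv_symm {P Q : C} {F : OMod O} (m : val F P) (φ : Q ⟶ P) :
    app ((freeEquiv P F).symm m) Q (freeGen φ) = res F φ m := by
  exact ModuleCat.freeDesc_apply _ _

/-- Yoneda: the identity of `free O P` corresponds to the universal section `freeGen (𝟙 P)`, so
every basis element is a restriction of that section. -/
theorem res_freeGen {P Q R : C} (φ : Q ⟶ P) (ψ : R ⟶ Q) :
    res (free O P) ψ (freeGen φ) = freeGen (ψ ≫ φ) := by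
  have h : 𝟙 (free O P) = (freeEquiv P _).symm (freeGen (𝟙 P)) :=
    ((freeEquiv P _).symm_apply_apply (𝟙 (free O P))).symm
  have key (Q : C) (φ : Q ⟶ P) : freeGen φ = res (free O P) φ (freeGen (𝟙 P)) := by
    refine Eq.trans ?_ (app_freeEquiv_symm (freeGen (𝟙 P)) φ)
    rw [← h]; rfl
  rw [key _ φ, key _ (ψ ≫ φ), res_comp]

theorem freeEquiv_comp {P : C} {F G : OMod O} (f : free O P ⟶ F) (g : F ⟶ G) :
    freeEquiv P G (f ≫ g) = app g P (freeEquiv P F f) := rfl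

theorem freeEquiv_symm_comp {P : C} {F G : OMod O} (m : val F P) (g : F ⟶ G) :
    (freeEquiv P F).symm m ≫ g = (freeEquiv P G).symm (app g P m) := by
  apply (freeEquiv P G).injective
  rw [freeEquiv_comp, LinearEquiv.apply_symm_apply, LinearEquiv.apply_symm_apply]

instance (P : C) : Projective (free O P) where
  factors {E X} f e _ := by
    obtain ⟨m, hm⟩ : ∃ m : val E P, app e P m = freeEquiv P X f :=
      PresheafOfModules.surjective_of_epi e (op P) (freeEquiv P X f)
    refine ⟨(freeEquiv P E).symm m, ?_⟩
    rw [freeEquiv_symm_comp, hm, LinearEquiv.symm_apply_apply]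

/-- The morphism `free O P ⟶ free O Q` induced by `f : P ⟶ Q`. -/
def freeMap {P Q : C} (f : P ⟶ Q) : free O P ⟶ free O Q :=
  (freeEquiv P _).symm (freeGen f)

theorem freeEquiv_freeMap {P Q : C} (f : P ⟶ Q) {F : OMod O} (g : free O Q ⟶ F) :
    freeEquiv P F (freeMap f ≫ g) = res F f (freeEquiv Q F g) := by
  rw [freeMap, freeEquiv_symm_comp, LinearEquiv.apply_symm_apply, freeEquiv_apply, ← app_res,
    res_freeGen, Category.comp_id]

theorem mono_of_app {F G : OMod O} (f : F ⟶ G) (h : ∀ P, Function.Injective (app f P)) :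
    Mono f :=
  PresheafOfModules.mono_of_injective fun X => h X.unop

/-- The action of the sections of `O` on those of an `O`-module. -/
def osmul {F : OMod O} {P : C} (a : O.obj (op P)) (m : val F P) : val F P :=
  show F.obj (op P) from (show (ringSheaf O).obj (op P) from a) • (show F.obj (op P) from m)

theorem app_osmul {F G : OMod O} (g : F ⟶ G) {P : C} (a : O.obj (op P)) (m : val F P) :
    app g P (osmul a m) = osmul a (app g P m) :=
  (g.app (op P)).hom.map_smul _ m

theorem res_osmul {F : OMod O} {P Q : C} (f : P ⟶ Q) (a : O.obj (op Q)) (m : val F Q) :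
    res F f (osmul a m) = osmul (O.map f.op a) (res F f m) :=
  F.map_smul f.op a m

theorem osmul_osmul {F : OMod O} {P : C} (a b : O.obj (op P)) (m : val F P) :
    osmul a (osmul b m) = osmul (a * b) m :=
  smul_smul (M := (ringSheaf O).obj (op P)) (α := F.obj (op P)) a b m

theorem one_osmul {F : OMod O} {P : C} (m : val F P) : osmul (1 : O.obj (op P)) m = m :=
  one_smul ((ringSheaf O).obj (op P)) (show F.obj (op P) from m)

/-- The morphism `free O P ⟶ free O P`, which is multiplication by the section `a` over `P`. -/
def freeMul (P : C) (a : O.obj (op P)) : free O P ⟶ free O P :=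
  (freeEquiv P _).symm (osmul a (freeGen (𝟙 P)))

theorem freeEquiv_freeMul {P : C} (a : O.obj (op P)) {F : OMod O} (g : free O P ⟶ F) :
    freeEquiv P F (freeMul P a ≫ g) = osmul a (freeEquiv P F g) := by
  rw [freeMul, freeEquiv_symm_comp, LinearEquiv.apply_symm_apply, app_osmul, freeEquiv_apply]

/-- The sections of `free O P` over `Q`, as finitely supported functions. -/
def freeCoeff {P Q : C} : val (free O P) Q ≃+ ((Q ⟶ P) →₀ O.obj (op Q)) :=
  (show val (free O P) Q ≃+ (ULift.{u} (Q ⟶ P) →₀ O.obj (op Q)) from AddEquiv.refl _).trans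
    (Finsupp.domCongr Equiv.ulift)

theorem freeCoeff_osmul_freeGen {P Q : C} (a : O.obj (op Q)) (φ : Q ⟶ P) :
    freeCoeff (osmul a (freeGen φ)) = Finsupp.single φ a := by
  have h : (osmul a (freeGen φ) : val (free O P) Q) =
      (Finsupp.single (ULift.up φ) a : ULift.{u} (Q ⟶ P) →₀ O.obj (op Q)) := by
    refine (Finsupp.smul_single _ _ _).trans ?_
    exact congrArg (Finsupp.single (ULift.up φ)) (mul_one (M := O.obj (op Q)) a)
  rw [h]
  exact Finsupp.equivMapDomain_single _ _ _

theorem free_induction {P Q : C} {p : val (free O P) Q → Prop} (x : val (free O P) Q)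
    (zero : p 0) (add : ∀ x y, p x → p y → p (x + y))
    (osmul_freeGen : ∀ (a : O.obj (op Q)) (φ : Q ⟶ P), p (osmul a (freeGen φ))) : p x := by
  obtain ⟨x, rfl⟩ := freeCoeff.symm.surjective x
  induction x using Finsupp.induction_linear with
  | zero => rwa [map_zero]
  | add x y hx hy => rw [map_add]; exact add _ _ hx hy
  | single φ a =>
    rw [← freeCoeff_osmul_freeGen, AddEquiv.symm_apply_apply]
    exact osmul_freeGen a φ

theorem app_freeMul_osmul {P Q : C} (φ : Q ⟶ P) (a : O.obj (op P)) (b : O.obj (op Q)) :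
    app (freeMul P a) Q (osmul b (freeGen φ)) = osmul (b * O.map φ.op a) (freeGen φ) := by
  rw [app_osmul, freeMul, app_freeEquiv_symm, res_osmul, res_freeGen, Category.comp_id,
    osmul_osmul]

/-- Multiplication by `a` is diagonal in the basis of arrows, which reduces its injectivity to
regularity of the restrictions of `a`. -/
theorem freeCoeff_freeMul {P Q : C} (a : O.obj (op P)) (x : val (free O P) Q) (φ : Q ⟶ P) :
    freeCoeff (app (freeMul P a) Q x) φ = freeCoeff x φ * O.map φ.op a := by
  induction x using free_induction with
  | zero => simp
  | add x y hx hy => simp only [map_add, Finsupp.add_apply, hx, hy, add_mul]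
  | osmul_freeGen b ψ =>
    rw [app_freeMul_osmul, freeCoeff_osmul_freeGen, freeCoeff_osmul_freeGen]
    by_cases h : ψ = φ
    · subst h; simp
    · simp [Finsupp.single_eq_of_ne' h]

theorem freeCoeff_freeMap {P Q R : C} (f : P ⟶ Q) (x : val (free O P) R) :
    freeCoeff (app (freeMap f) R x) = (freeCoeff x).mapDomain (· ≫ f) := by
  induction x using free_induction with
  | zero => simp
  | add x y hx hy => simp only [map_add, hx, hy, Finsupp.mapDomain_add]
  | osmul_freeGen b ψ =>
    rw [app_osmul, freeMap, app_freeEquiv_symm, res_freeGen, freeCoeff_osmul_freeGen,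
      freeCoeff_osmul_freeGen, Finsupp.mapDomain_single]

instance {P Q : C} (f : P ⟶ Q) [Mono f] : Mono (freeMap (O := O) f) := by
  refine mono_of_app _ fun R x y h => freeCoeff.injective ?_
  refine Finsupp.mapDomain_injective (f := fun g : R ⟶ P => g ≫ f)
    (fun a b hab => (cancel_mono f).1 hab) ?_
  rw [← freeCoeff_freeMap, ← freeCoeff_freeMap, h]

theorem mono_freeMul {P : C} (a : O.obj (op P))
    (h : ∀ {Q} (φ : Q ⟶ P), IsRightRegular (O.map φ.op a)) : Mono (freeMul P a) := by
  refine mono_of_app _ fun R x y hxy => freeCoeff.injective (Finsupp.ext fun φ => h φ ?_)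
  change freeCoeff x φ * O.map φ.op a = freeCoeff y φ * O.map φ.op a
  rw [← freeCoeff_freeMul, ← freeCoeff_freeMul, hxy]

/-! ### Global sections -/

/-- A family of compatible sections is a morphism out of the structure sheaf. -/
def ofSections {F : OMod O} (s : ∀ P, val F P) (hs : ∀ {P Q} (f : P ⟶ Q), res F f (s Q) = s P) :
    structureSheaf O ⟶ F :=
  F.unitHomEquiv.symm (PresheafOfModules.sectionsMk (fun X => s X.unop) fun _ _ f => hs f.unop)

/-- The section `1` of the structure sheaf. -/
def one (P : C) : val (structureSheaf O) P := (1 : O.obj (op P))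

theorem res_one {P Q : C} (f : P ⟶ Q) : res (structureSheaf O) f (one Q) = one P :=
  PresheafOfModules.unit_map_one (ringSheaf O) f.op

theorem app_ofSections_one {F : OMod O} (s : ∀ P, val F P)
    (hs : ∀ {P Q} (f : P ⟶ Q), res F f (s Q) = s P) (P : C) :
    app (ofSections s hs) P (one P) = s P :=
  congrArg (fun t : F.sections => t.1 (op P)) (F.unitHomEquiv.apply_symm_apply
    (PresheafOfModules.sectionsMk (fun X => s X.unop) fun _ _ f => hs f.unop))

theorem hom_ext_one {F : OMod O} {f g : structureSheaf O ⟶ F}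
    (h : ∀ P, app f P (one P) = app g P (one P)) : f = g :=
  F.unitHomEquiv.injective (PresheafOfModules.sections_ext _ _ fun X => h X.unop)

end Generators

/-! ### The cohomology of modules on the category with five objects -/

namespace C2V

open Limits

instance (P Q : C2V) : Subsingleton (P ⟶ Q) where
  allEq f g := by
    change Hom P Q at f g
    cases f <;> cases g <;> rfl

instance (i : Fin 2) : Mono (e i) where
  right_cancellation _ _ _ := Subsingleton.elim _ _

variable {k : Type u} [Field k] (O : C2Vᵒᵖ ⥤ AlgCat.{u} k)

instance : HasFiniteBiproducts (OMod O) := Abelian.hasFiniteBiproducts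

instance (P : Fin 2 → C2V) : Projective (⨁ fun i => free O (P i)) where
  factors f e _ := ⟨biproduct.desc fun i =>
      Projective.factorThru (biproduct.ι (fun i => free O (P i)) i ≫ f) e,
    biproduct.hom_ext' _ _ fun i => by simp⟩

/-- The free module on the objects `A i`. -/
abbrev cechOne : OMod O := ⨁ fun i : Fin 2 => free O (A i)

/-- The free module on the objects `B i` and `B₃`. -/
abbrev cechZero : OMod O := (⨁ fun i : Fin 2 => free O (B i)) ⊞ free O B₃

variable {O} in
/-- Morphisms out of `cechOne O`. -/
def cechOneEquiv (F : OMod O) : (cechOne O ⟶ F) ≃ₗ[k] ∀ i, val F (A i) where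
  toFun f i := freeEquiv (A i) F (biproduct.ι (fun i : Fin 2 => free O (A i)) i ≫ f)
  map_add' f g := funext fun i => by rw [Preadditive.comp_add, map_add]; rfl
  map_smul' c f := funext fun i => by rw [Linear.comp_smul, map_smul]; rfl
  invFun m := biproduct.desc fun i => (freeEquiv (A i) F).symm (m i)
  left_inv f := biproduct.hom_ext' _ _ fun i => by simp
  right_inv m := funext fun i => by simp

variable {O} in
/-- Morphisms out of `cechZero O`. -/
def cechZeroEquiv (F : OMod O) :
    (cechZero O ⟶ F) ≃ₗ[k] (∀ i, val F (B i)) × val F B₃ where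
  toFun f := (fun i =>
      freeEquiv (B i) F (biproduct.ι (fun i : Fin 2 => free O (B i)) i ≫ biprod.inl ≫ f),
    freeEquiv B₃ F (biprod.inr ≫ f))
  map_add' f g := Prod.ext (funext fun i => by simp only [Preadditive.comp_add, map_add]; rfl)
    (by simp only [Preadditive.comp_add, map_add]; rfl)
  map_smul' c f := Prod.ext (funext fun i => by simp only [Linear.comp_smul, map_smul]; rfl)
    (by simp only [Linear.comp_smul, map_smul]; rfl)
  invFun m := biprod.desc (biproduct.desc fun i => (freeEquiv (B i) F).symm (m.1 i))
    ((freeEquiv B₃ F).symm m.2)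
  left_inv f := biprod.hom_ext' _ _ (biproduct.hom_ext' _ _ fun i => by simp) (by simp)
  right_inv m := Prod.ext (funext fun i => by simp) (by simp)

variable {O} in
theorem cechOneEquiv_comp {F G : OMod O} (f : cechOne O ⟶ F) (g : F ⟶ G) :
    cechOneEquiv G (f ≫ g) = fun j => app g (A j) (cechOneEquiv F f j) := rfl

variable {O} in
theorem cechZeroEquiv_comp {F G : OMod O} (f : cechZero O ⟶ F) (g : F ⟶ G) :
    cechZeroEquiv G (f ≫ g) = (fun j => app g (B j) ((cechZeroEquiv F f).1 j),
      app g B₃ (cechZeroEquiv F f).2) := rfl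

/-- The differential `cechOne O ⟶ cechZero O`. -/
def cechD : cechOne O ⟶ cechZero O :=
  biprod.lift (biproduct.map fun i => freeMap (e i)) (-biproduct.desc fun i => freeMap (e₃ i))

/-- The augmentation `cechZero O ⟶ structureSheaf O`. -/
def cechAug : cechZero O ⟶ structureSheaf O :=
  (cechZeroEquiv (structureSheaf O)).symm (fun _ => one _, one _)

variable {O} in
-- This turns statements about Ext into statements about sections: precomposition with the
-- differential is the coboundary.
theorem cechOneEquiv_cechD {F : OMod O} (g : cechZero O ⟶ F) :
    cechOneEquiv F (cechD O ≫ g) = coboundary F (cechZeroEquiv F g) := by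
  obtain ⟨g₁, g₂, rfl⟩ : ∃ g₁ g₂, g = biprod.desc g₁ g₂ :=
    ⟨biprod.inl ≫ g, biprod.inr ≫ g, biprod.hom_ext' _ _ (by simp) (by simp)⟩
  funext i
  change freeEquiv (A i) F (biproduct.ι (fun i : Fin 2 => free O (A i)) i ≫ cechD O ≫ _) =
    res F (e i) (freeEquiv (B i) F (biproduct.ι (fun i : Fin 2 => free O (B i)) i ≫ biprod.inl ≫ _)) -
      res F (e₃ i) (freeEquiv B₃ F (biprod.inr ≫ _))
  rw [biprod.inl_desc, biprod.inr_desc, ← freeEquiv_freeMap, ← freeEquiv_freeMap, ← map_sub]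
  congr 1
  simp [cechD, sub_eq_add_neg]

variable {O} in
theorem cechZeroEquiv_cechAug {F : OMod O} (g : structureSheaf O ⟶ F) :
    cechZeroEquiv F (cechAug O ≫ g) = (fun _ => app g _ (one _), app g _ (one _)) := by
  rw [cechZeroEquiv_comp, cechAug, LinearEquiv.apply_symm_apply]

/-- The component towards the `B i` is already mono, being a biproduct of the maps induced by the
monomorphisms `e i`. -/
instance : Mono (cechD O) := by
  have h : cechD O ≫ biprod.fst = biproduct.map fun i => freeMap (e i) := biprod.lift_fst _ _
  exact mono_of_mono_fac h

theorem cechD_aug : cechD O ≫ cechAug O = 0 := by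
  apply (cechOneEquiv _).injective
  rw [cechOneEquiv_cechD, ← Category.comp_id (cechAug O), cechZeroEquiv_cechAug, map_zero]
  funext i
  change res (structureSheaf O) (e i) (one _) - res (structureSheaf O) (e₃ i) (one _) = 0
  rw [res_one, res_one, sub_self]

/-- The resolution `0 ⟶ cechOne O ⟶ cechZero O ⟶ structureSheaf O ⟶ 0`. -/
abbrev cech : ShortComplex (OMod O) := ShortComplex.mk (cechD O) (cechAug O) (cechD_aug O)

/-- A morphism out of the structure sheaf is determined by its values on `1`, and those over `A i`
are restrictions from `B i`. -/
instance : Epi (cechAug O) where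
  left_cancellation {F} f g h := by
    replace h := congrArg (cechZeroEquiv F) h
    rw [cechZeroEquiv_cechAug, cechZeroEquiv_cechAug, Prod.mk.injEq] at h
    have hB (i : Fin 2) : app f (B i) (one _) = app g (B i) (one _) := congrFun h.1 i
    refine hom_ext_one fun P => ?_
    cases P with
    | A i => rw [← res_one (e i), app_res, app_res, hB]
    | B i => exact hB i
    | B₃ => exact h.2

/-- Gluing: a family killed by the coboundary agrees over each `A i`, hence extends to a compatible
family over all objects. Thus `cechAug` is a cokernel of `cechD`. -/
theorem exists_cechAug_comp {F : OMod O} (g : cechZero O ⟶ F) (hg : cechD O ≫ g = 0) :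
    ∃ f : structureSheaf O ⟶ F, cechAug O ≫ f = g := by
  replace hg := congrArg (cechOneEquiv F) hg
  rw [cechOneEquiv_cechD, map_zero] at hg
  obtain ⟨⟨m, m₃⟩, rfl⟩ := (cechZeroEquiv F).symm.surjective g
  rw [LinearEquiv.apply_symm_apply] at hg
  have h (i : Fin 2) : res F (e i) (m i) = res F (e₃ i) m₃ := sub_eq_zero.1 (congrFun hg i)
  let s : ∀ P, val F P
    | A i => res F (e i) (m i)
    | B i => m i
    | B₃ => m₃
  refine ⟨ofSections s fun {P Q} f => ?_, ?_⟩
  · change Hom P Q at f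
    cases f with
    | id => exact res_id _
    | e i => rfl
    | e₃ i => exact (h i).symm
  · apply (cechZeroEquiv F).injective
    rw [cechZeroEquiv_cechAug, LinearEquiv.apply_symm_apply]
    simp only [app_ofSections_one]
    rfl

theorem cech_shortExact : (cech O).ShortExact where
  exact := ShortComplex.exact_of_g_is_cokernel _ (CokernelCofork.IsColimit.ofπ _ _
    (fun g hg => (exists_cechAug_comp O g hg).choose)
    (fun g hg => (exists_cechAug_comp O g hg).choose_spec)
    (fun g hg f hf => by
      rw [← cancel_epi (cechAug O), (exists_cechAug_comp O g hg).choose_spec]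
      exact hf))
  mono_f := inferInstanceAs (Mono (cechD O))
  epi_g := inferInstanceAs (Epi (cechAug O))

variable {O}

/-- The map onto `H¹(F)` from the sections of `F` over the objects `A i`. -/
def cechClass (F : OMod O) : (∀ i, val F (A i)) →ₗ[k] H 1 F :=
  connecting (cech_shortExact O) k F ∘ₗ (cechOneEquiv F).symm.toLinearMap

theorem cechClass_surjective (F : OMod O) : Function.Surjective (cechClass F) :=
  have : Projective (cech O).X₂ := inferInstanceAs (Projective (cechZero O))
  (connecting_surjective (cech_shortExact O) k F).comp (cechOneEquiv F).symm.surjective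

theorem ker_cechClass (F : OMod O) :
    LinearMap.ker (cechClass F) = LinearMap.range (coboundary F) := by
  ext m
  refine (connecting_eq_zero_iff (cech_shortExact O) k ((cechOneEquiv F).symm m)).trans ⟨?_, ?_⟩
  · rintro ⟨g, hg⟩
    refine ⟨cechZeroEquiv F g, ?_⟩
    rw [← cechOneEquiv_cechD]
    exact (congrArg (cechOneEquiv F) hg).trans (LinearEquiv.apply_symm_apply _ _)
  · rintro ⟨s, rfl⟩
    refine ⟨(cechZeroEquiv F).symm s, (cechOneEquiv F).injective ?_⟩
    refine (cechOneEquiv_cechD _).trans ?_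
    rw [LinearEquiv.apply_symm_apply, LinearEquiv.apply_symm_apply]

/-- The first cohomology group is the cokernel of the coboundary. -/
def quotCoboundaryEquiv (F : OMod O) :
    ((∀ i, val F (A i)) ⧸ LinearMap.range (coboundary F)) ≃ₗ[k] H 1 F :=
  (Submodule.quotEquivOfEq _ _ (ker_cechClass F).symm).trans
    ((cechClass F).quotKerEquivOfSurjective (cechClass_surjective F))

theorem subsingleton_H (F : OMod O) {n : ℕ} (hn : 2 ≤ n) : Subsingleton (H n F) :=
  have : Projective (cech O).X₁ := inferInstanceAs (Projective (cechOne O))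
  have : Projective (cech O).X₂ := inferInstanceAs (Projective (cechZero O))
  subsingleton_ext_of_shortExact (cech_shortExact O) F hn

end C2V

/-! ### The cokernel of the coboundary of `ω` -/

section Cokernel

open C2V Polynomial LaurentPolynomial

variable (k : Type u) [Field k] (r : ℕ)

theorem resB_C_mul_X_pow (a : k) (n : ℕ) :
    resB k (Polynomial.C a * X ^ n) = LaurentPolynomial.C a * T (-n) := by
  rw [resB, map_mul, map_pow, aeval_C, aeval_X, T_pow, mul_neg_one]
  rfl

theorem resB₃_C_mul_T (i : Fin 2) (a : k) (n : ℤ) :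
    resB₃ k r i (LaurentPolynomial.C a * T n) = LaurentPolynomial.C a * T (wind r i * n) := by
  rw [← single_eq_C_mul_T, ← single_eq_C_mul_T]
  exact AddMonoidAlgebra.mapDomain_single

/-- The coboundary of `ω` in terms of Laurent polynomials. -/
def omegaCoboundary :
    (Fin 2 → k[X]) × (Fin r → k[T;T⁻¹]) →+ (Fin 2 → k[T;T⁻¹]) where
  toFun s i := resMB k ((r : ℤ) - 2) (s.1 i) - resMB₃ k r i s.2
  map_zero' := by
    funext i
    simp only [Prod.fst_zero, Prod.snd_zero, Pi.zero_apply, map_zero, sub_zero]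
  map_add' s t := by
    funext i
    simp only [Prod.fst_add, Prod.snd_add, Pi.add_apply, map_add]
    abel

theorem omegaCoboundary_apply (s : (Fin 2 → k[X]) × (Fin r → k[T;T⁻¹])) (i : Fin 2) :
    omegaCoboundary k r s i = resMB k ((r : ℤ) - 2) (s.1 i) - resMB₃ k r i s.2 := rfl

theorem coeff_resMB (n m : ℤ) (h : n < m) (p : k[X]) : (resMB k n p).coeff m = 0 := by
  induction p using Polynomial.induction_on' with
  | add p q hp hq => rw [map_add, AddMonoidAlgebra.coeff_add, Finsupp.add_apply, hp, hq, add_zero]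
  | monomial j a =>
    rw [← C_mul_X_pow_eq_monomial]
    change (T n * resB k _).coeff m = 0
    rw [resB_C_mul_X_pow, T_mul, mul_assoc, ← T_add, ← single_eq_C_mul_T,
      AddMonoidAlgebra.coeff_single, Finsupp.single_eq_of_ne (by omega)]

theorem resMB₃_single (i : Fin 2) (j : Fin r) (a : k) (n : ℤ) :
    resMB₃ k r i (Pi.single j (LaurentPolynomial.C a * T n)) =
      LaurentPolynomial.C a * T (j + wind r i * n) := by
  change ∑ l : Fin r, T ((l : ℕ) : ℤ) * resB₃ k r i _ = _
  rw [Finset.sum_eq_single j, Pi.single_eq_same, resB₃_C_mul_T, T_mul, mul_assoc, ← T_add,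
    add_comm]
  · intro l _ hl
    rw [Pi.single_eq_of_ne hl, map_zero, mul_zero]
  · intro h
    exact absurd (Finset.mem_univ j) h

/-- Since `0 ≤ j < r`, either of `j + r n = r - 1` and `j - r n = r - 1` forces `n = 0`, and then
the two conditions coincide. -/
theorem coeff_resMB₃ (q : Fin r → k[T;T⁻¹]) :
    (resMB₃ k r 0 q).coeff ((r : ℤ) - 1) = (resMB₃ k r 1 q).coeff ((r : ℤ) - 1) := by
  rw [← Finset.univ_sum_single q, map_sum, map_sum, AddMonoidAlgebra.coeff_sum,
    AddMonoidAlgebra.coeff_sum, Finsupp.finsetSum_apply, Finsupp.finsetSum_apply]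
  refine Finset.sum_congr rfl fun j _ => ?_
  generalize q j = f
  induction f using LaurentPolynomial.induction_on' with
  | add f g hf hg =>
    rw [Pi.single_add, map_add, map_add, AddMonoidAlgebra.coeff_add, AddMonoidAlgebra.coeff_add,
      Finsupp.add_apply, Finsupp.add_apply, hf, hg]
  | C_mul_T n a =>
    rw [resMB₃_single, resMB₃_single, ← single_eq_C_mul_T, ← single_eq_C_mul_T,
      AddMonoidAlgebra.coeff_single, AddMonoidAlgebra.coeff_single, Finsupp.single_apply,
      Finsupp.single_apply]
    have hj := j.isLt
    refine if_congr ?_ rfl rfl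
    change (j : ℤ) + r * n = r - 1 ↔ (j : ℤ) + -r * n = r - 1
    rcases lt_trichotomy n 0 with h | rfl | h
    · constructor <;> intro <;> nlinarith
    · simp
    · constructor <;> intro <;> nlinarith

/-- Sections over `B i` reach only exponents at most `r - 2`, so the coefficient at `r - 1` comes
from `B₃` alone, where both sides agree. -/
theorem omegaCoboundary_coeff (s : (Fin 2 → k[X]) × (Fin r → k[T;T⁻¹])) :
    (omegaCoboundary k r s 0).coeff ((r : ℤ) - 1) =
      (omegaCoboundary k r s 1).coeff ((r : ℤ) - 1) := by
  have h (i : Fin 2) : (omegaCoboundary k r s i).coeff ((r : ℤ) - 1) =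
      -(resMB₃ k r i s.2).coeff ((r : ℤ) - 1) := by
    have h₁ := coeff_resMB k ((r : ℤ) - 2) ((r : ℤ) - 1) (by omega) (s.1 i)
    have h₂ := congrArg (fun f : ℤ →₀ k => f ((r : ℤ) - 1)) (AddMonoidAlgebra.coeff_sub
      (resMB k ((r : ℤ) - 2) (s.1 i)) (resMB₃ k r i s.2))
    refine h₂.trans ?_
    rw [Finsupp.sub_apply, h₁, zero_sub]
  rw [h, h, coeff_resMB₃]

theorem single_mem_range_of_lt (i : Fin 2) (a : k) (m : ℤ) (hm : m < (r : ℤ) - 1) :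
    (Pi.single i (LaurentPolynomial.C a * T m) : Fin 2 → k[T;T⁻¹]) ∈
      (omegaCoboundary k r).range := by
  obtain ⟨n, hn⟩ := Int.eq_ofNat_of_zero_le (show 0 ≤ (r : ℤ) - 2 - m by omega)
  refine ⟨(Pi.single i (Polynomial.C a * X ^ n), 0), ?_⟩
  funext l
  rw [omegaCoboundary_apply, map_zero, sub_zero]
  dsimp only
  by_cases h : l = i
  · subst h
    rw [Pi.single_eq_same, Pi.single_eq_same]
    change T _ * resB k _ = _
    rw [resB_C_mul_X_pow, T_mul, mul_assoc, ← T_add]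
    congr 2
    omega
  · rw [Pi.single_eq_of_ne h, Pi.single_eq_of_ne h, map_zero]

theorem add_single_mem_range (j : ℕ) (hj : j < r) (a : k) (n : ℤ) :
    (Pi.single 0 (LaurentPolynomial.C a * T (j + r * n)) +
      Pi.single 1 (LaurentPolynomial.C a * T (j - r * n)) : Fin 2 → k[T;T⁻¹]) ∈
        (omegaCoboundary k r).range := by
  -- The sign cancels the minus sign in front of the `B₃` term of the coboundary.
  refine ⟨(0, Pi.single ⟨j, hj⟩ (-(LaurentPolynomial.C a * T n))), ?_⟩
  funext l
  rw [omegaCoboundary_apply]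
  dsimp only
  rw [Pi.zero_apply, map_zero, zero_sub, Pi.single_neg, map_neg, neg_neg, resMB₃_single]
  fin_cases l
  · simp [wind]
  · simp [wind, sub_eq_add_neg]

variable (hr : 1 ≤ r)
include hr

theorem single_mem_range (i : Fin 2) (a : k) (m : ℤ) (hm : m ≠ (r : ℤ) - 1) :
    (Pi.single i (LaurentPolynomial.C a * T m) : Fin 2 → k[T;T⁻¹]) ∈
      (omegaCoboundary k r).range := by
  rcases lt_or_gt_of_ne hm with h | h
  · exact single_mem_range_of_lt k r i a m h
  have hr' : (0 : ℤ) < r := by omega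
  obtain ⟨j, hj⟩ := Int.eq_ofNat_of_zero_le (Int.emod_nonneg m hr'.ne')
  have hjr := Int.emod_lt_of_pos m hr'
  have hm' := Int.mul_ediv_add_emod m r
  -- Here `m ≥ r`; the mirror exponent `j - r * (m / r)` is then negative, so the monomial on the
  -- other side comes from a section over its `B`.
  have hn : 1 ≤ m / r := by
    by_contra! hn
    nlinarith
  have hlt : (j : ℤ) - r * (m / r) < (r : ℤ) - 1 := by nlinarith
  fin_cases i
  · have := (omegaCoboundary k r).range.sub_mem (add_single_mem_range k r j (by omega) a (m / r))
      (single_mem_range_of_lt k r 1 a _ hlt)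
    rw [add_sub_cancel_right, show (j : ℤ) + r * (m / r) = m by omega] at this
    exact this
  · have := (omegaCoboundary k r).range.sub_mem (add_single_mem_range k r j (by omega) a (-(m / r)))
      (single_mem_range_of_lt k r 0 a (j + r * -(m / r)) (by rw [mul_neg]; exact hlt))
    rw [add_sub_cancel_left, show (j : ℤ) - r * -(m / r) = m by rw [mul_neg]; omega] at this
    exact this

theorem exists_sub_single_mem_range (f : Fin 2 → k[T;T⁻¹]) :
    ∃ c : k, f - Pi.single 0 (LaurentPolynomial.C c * T ((r : ℤ) - 1)) ∈
      (omegaCoboundary k r).range := by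
  have key (i : Fin 2) (f : k[T;T⁻¹]) :
      ∃ c : k, (Pi.single i f - Pi.single 0 (LaurentPolynomial.C c * T ((r : ℤ) - 1)) :
        Fin 2 → k[T;T⁻¹]) ∈ (omegaCoboundary k r).range := by
    induction f using LaurentPolynomial.induction_on' with
    | add f g hf hg =>
      obtain ⟨c, hc⟩ := hf
      obtain ⟨d, hd⟩ := hg
      refine ⟨c + d, ?_⟩
      have := add_mem hc hd
      rwa [sub_add_sub_comm, ← Pi.single_add, ← Pi.single_add, ← add_mul, ← map_add] at this
    | C_mul_T m a =>
      by_cases hm : m = (r : ℤ) - 1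
      · subst hm
        fin_cases i
        · exact ⟨a, by simp⟩
        -- The relation with `j = r - 1` and `n = 0` moves `x₂ ^ (r - 1)` to `-x₁ ^ (r - 1)`.
        · refine ⟨-a, ?_⟩
          have := add_single_mem_range k r (r - 1) (by omega) a 0
          rw [mul_zero, add_zero, sub_zero, Nat.cast_sub hr, Nat.cast_one] at this
          rwa [map_neg, neg_mul, Pi.single_neg, sub_neg_eq_add, add_comm]
      · refine ⟨0, ?_⟩
        rw [map_zero, zero_mul, Pi.single_zero, sub_zero]
        exact single_mem_range k r hr i a m hm
  obtain ⟨c, hc⟩ := key 0 (f 0)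
  obtain ⟨d, hd⟩ := key 1 (f 1)
  refine ⟨c + d, ?_⟩
  have := add_mem hc hd
  rw [sub_add_sub_comm, ← Pi.single_add, ← add_mul, ← map_add] at this
  convert this using 2
  rw [← Finset.univ_sum_single f, Fin.sum_univ_two]
  simp

omit hr

/-- The functional `(f₁, f₂) ↦ a - b`, where `a` and `b` are the coefficients of `x₁ ^ (r - 1)` in
`f₁` and of `x₂ ^ (r - 1)` in `f₂`. -/
def residue : (∀ i, val (omega k r) (A i)) →ₗ[k] k where
  toFun f := (show k[T;T⁻¹] from f 0).coeff ((r : ℤ) - 1) -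
    (show k[T;T⁻¹] from f 1).coeff ((r : ℤ) - 1)
  map_add' f g := by
    change ((show k[T;T⁻¹] from f 0) + (show k[T;T⁻¹] from g 0)).coeff _ -
      ((show k[T;T⁻¹] from f 1) + (show k[T;T⁻¹] from g 1)).coeff _ = _
    rw [AddMonoidAlgebra.coeff_add, AddMonoidAlgebra.coeff_add, Finsupp.add_apply,
      Finsupp.add_apply]
    ring
  map_smul' c f := by
    change (algebraMap k k[T;T⁻¹] c * (show k[T;T⁻¹] from f 0)).coeff _ -
      (algebraMap k k[T;T⁻¹] c * (show k[T;T⁻¹] from f 1)).coeff _ = _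
    rw [← Algebra.smul_def, ← Algebra.smul_def, AddMonoidAlgebra.coeff_smul,
      AddMonoidAlgebra.coeff_smul, Finsupp.smul_apply, Finsupp.smul_apply, ← smul_sub]
    rfl

/-- The family of sections of `ω` over `A₁`, `A₂` which is `f` at `A i` and `0` elsewhere. -/
def omegaSingle (i : Fin 2) (f : k[T;T⁻¹]) : ∀ i, val (omega k r) (A i) :=
  Pi.single (M := fun _ => k[T;T⁻¹]) i f

theorem residue_single (i : Fin 2) (f : k[T;T⁻¹]) :
    residue k r (omegaSingle k r i f) =
      ![1, -1] i * f.coeff ((r : ℤ) - 1) := by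
  change (Pi.single (M := fun _ => k[T;T⁻¹]) i f 0).coeff _ -
    (Pi.single (M := fun _ => k[T;T⁻¹]) i f 1).coeff _ = _
  fin_cases i <;> simp

theorem residue_surjective : Function.Surjective (residue k r) := fun c =>
  ⟨omegaSingle k r 0 (LaurentPolynomial.C c * T ((r : ℤ) - 1)), by
    rw [residue_single, ← single_eq_C_mul_T]
    simp [AddMonoidAlgebra.coeff_single, -single_eq_C_mul_T]⟩

theorem residue_coboundary (s) : residue k r (coboundary (omega k r) s) = 0 :=
  sub_eq_zero.2 (omegaCoboundary_coeff k r s)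

include hr in
theorem ker_residue : LinearMap.ker (residue k r) = LinearMap.range (coboundary (omega k r)) := by
  ext f
  constructor
  · intro hf
    obtain ⟨c, s, hs⟩ := exists_sub_single_mem_range k r hr f
    have hs' : coboundary (omega k r) s =
      f - omegaSingle k r 0 (LaurentPolynomial.C c * T ((r : ℤ) - 1)) := hs
    have h := residue_coboundary k r s
    rw [hs', map_sub, LinearMap.mem_ker.1 hf, residue_single, ← single_eq_C_mul_T] at h
    have hc : c = 0 := by simpa [AddMonoidAlgebra.coeff_single, -single_eq_C_mul_T] using h
    refine ⟨s, hs'.trans ?_⟩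
    rw [hc, map_zero, zero_mul, omegaSingle, Pi.single_zero]
    exact sub_zero f
  · rintro ⟨s, rfl⟩
    exact residue_coboundary k r s

/-- The cokernel of the coboundary of `ω` is one-dimensional. -/
def residueEquiv : ((∀ i, val (omega k r) (A i)) ⧸
    LinearMap.range (coboundary (omega k r))) ≃ₗ[k] k :=
  (Submodule.quotEquivOfEq _ _ (ker_residue k r hr).symm).trans
    ((residue k r).quotKerEquivOfSurjective (residue_surjective k r))

end Cokernel

/-! ### The torsion skyscraper sheaves -/

section Exactness

variable {k : Type u} [Field k] {C : Type} [SmallCategory C] {O : Cᵒᵖ ⥤ AlgCat.{u} k}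

theorem exact_of_app (S : ShortComplex (OMod O))
    (h : ∀ P (x : val S.X₂ P), app S.g P x = 0 → ∃ y, app S.f P y = x) : S.Exact := by
  rw [S.exact_iff_epi_kernel_lift]
  refine PresheafOfModules.epi_of_surjective fun X z => ?_
  have hz : app S.g X.unop (app (Limits.kernel.ι S.g) X.unop z) = 0 :=
    congrArg (fun f => app f X.unop z) (Limits.kernel.condition S.g)
  obtain ⟨y, hy⟩ := h X.unop _ hz
  refine ⟨y, PresheafOfModules.injective_of_mono (Limits.kernel.ι S.g) X ?_⟩
  refine Eq.trans ?_ hy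
  exact congrArg (fun f => app f X.unop y) (Limits.kernel.lift_ι S.g S.f S.zero)

theorem subsingleton_val_sky {P Q : C} (M : ModuleCat.{u} ((ringSheaf O).obj (op P)))
    [IsEmpty (P ⟶ Q)] : Subsingleton (val (sky P M) Q) where
  allEq _ _ := funext fun φ => isEmptyElim φ

end Exactness

section Torsion

open C2V Polynomial LaurentPolynomial

variable (k : Type u) [Field k] (r : ℕ) (i : Fin 2)

/-- The section of the skyscraper sheaf which is `p mod y_i` everywhere. -/
def torsionSection (p : k[X]) (Q : C2V) : val (torsionSky k r i) Q :=
  fun _ => Ideal.Quotient.mk _ p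

theorem torsion_ext {Q : C2V} {s t : val (torsionSky k r i) Q}
    (h : ∀ φ : B i ⟶ Q, (s φ : k[X] ⧸ Ideal.span {(X : k[X])}) = t φ) : s = t :=
  funext h

theorem osmul_torsionSection (a p : k[X]) :
    osmul (P := B i) (show (sheafO k r).obj (op (B i)) from a) (torsionSection k r i p (B i)) =
      torsionSection k r i (a * p) (B i) := by
  refine torsion_ext k r i fun φ => ?_
  obtain rfl : φ = 𝟙 _ := Subsingleton.elim _ _
  rfl

theorem smul_torsionSection (c : k) (p : k[X]) :
    c • torsionSection k r i p (B i) = torsionSection k r i (Polynomial.C c * p) (B i) :=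
  osmul_torsionSection k r i (Polynomial.C c) p

theorem torsionSection_eq_zero_iff (p : k[X]) :
    torsionSection k r i p (B i) = 0 ↔ X ∣ p := by
  rw [← Ideal.mem_span_singleton, ← Ideal.Quotient.eq_zero_iff_mem]
  exact ⟨fun h => congrFun h (𝟙 _), fun h => torsion_ext k r i fun _ => h⟩

theorem torsionSection_surjective :
    Function.Surjective fun p => torsionSection k r i p (B i) := fun s => by
  obtain ⟨p, hp⟩ := Ideal.Quotient.mk_surjective (I := Ideal.span {(X : k[X])}) (s (𝟙 _))
  refine ⟨p, torsion_ext k r i fun φ => ?_⟩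
  obtain rfl : φ = 𝟙 _ := Subsingleton.elim _ _
  exact hp

theorem subsingleton_val_torsionSky {Q : C2V} (hQ : Q ≠ B i) :
    Subsingleton (val (torsionSky k r i) Q) :=
  have : IsEmpty (B i ⟶ Q) := ⟨fun φ => by
    change Hom _ _ at φ
    cases φ
    exact hQ rfl⟩
  subsingleton_val_sky _

/-- The coordinate `y_i`, as a section of `O` over `B i`. -/
def yB : (sheafO k r).obj (op (B i)) := (X : k[X])

/-- The augmentation of the resolution of the skyscraper sheaf. -/
def torsionAug : free (sheafO k r) (B i) ⟶ torsionSky k r i :=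
  (freeEquiv (B i) _).symm (torsionSection k r i 1 (B i))

theorem freeMul_torsionAug : freeMul (B i) (yB k r i) ≫ torsionAug k r i = 0 := by
  apply (freeEquiv (B i) _).injective
  rw [freeEquiv_freeMul, map_zero, torsionAug, LinearEquiv.apply_symm_apply]
  refine (osmul_torsionSection k r i X 1).trans ((torsionSection_eq_zero_iff k r i _).2 ?_)
  rw [mul_one]

/-- The resolution `0 ⟶ free O (B i) ⟶ free O (B i) ⟶ torsionSky k r i ⟶ 0`. -/
abbrev torsionRes : ShortComplex (OMod (sheafO k r)) :=
  ShortComplex.mk (freeMul (B i) (yB k r i)) (torsionAug k r i) (freeMul_torsionAug k r i)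

theorem resB_X : resB k X = T (-1) := aeval_X _

/-- The coordinate `y_i` is regular over `B i` and becomes the unit `1 / x_i` over `A i`; no other
object maps to `B i`. -/
instance : Mono (freeMul (B i) (yB k r i)) := by
  refine mono_freeMul _ fun {Q} φ => ?_
  change Hom Q (B i) at φ
  cases φ with
  | id => exact (isRegular_X (R := k)).right
  | e =>
    change IsRightRegular (resB k X)
    rw [resB_X]
    exact (isUnit_T (-1)).isRegular.right

theorem app_torsionAug (p : k[X]) :
    app (torsionAug k r i) (B i)
      (osmul (show (sheafO k r).obj (op (B i)) from p) (freeGen (𝟙 (B i)))) =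
        torsionSection k r i p (B i) := by
  rw [app_osmul, torsionAug, app_freeEquiv_symm, res_id, osmul_torsionSection, mul_one]

instance : Epi (torsionAug k r i) := by
  refine PresheafOfModules.epi_of_surjective fun X s => ?_
  by_cases h : X.unop = B i
  · obtain ⟨Q⟩ := X
    subst h
    obtain ⟨p, hp⟩ := torsionSection_surjective k r i s
    exact ⟨_, (app_torsionAug k r i p).trans hp⟩
  · have := subsingleton_val_torsionSky k r i h
    exact ⟨0, Subsingleton.elim (α := val (torsionSky k r i) X.unop) _ _⟩

/-- Hom-sets have at most one element, so a nonempty one makes the free module of rank one there. -/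
theorem eq_osmul_freeGen {O : C2Vᵒᵖ ⥤ AlgCat.{u} k} {P Q : C2V} (φ : Q ⟶ P)
    (x : val (free O P) Q) : x = osmul (freeCoeff x φ) (freeGen φ) := by
  apply freeCoeff.injective
  rw [freeCoeff_osmul_freeGen]
  ext ψ
  obtain rfl : φ = ψ := Subsingleton.elim _ _
  rw [Finsupp.single_eq_same]

theorem torsionRes_exact : (torsionRes k r i).Exact := by
  refine exact_of_app _ fun Q x hx => ?_
  change app (torsionAug k r i) Q x = 0 at hx
  change ∃ y, app (freeMul (B i) (yB k r i)) Q y = x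
  by_cases h : Nonempty (Q ⟶ B i)
  · obtain ⟨φ⟩ := h
    rw [eq_osmul_freeGen k φ x] at hx ⊢
    generalize freeCoeff x φ = a at hx
    suffices ∃ b : (sheafO k r).obj (op Q), b * (sheafO k r).map φ.op (yB k r i) = a by
      obtain ⟨b, rfl⟩ := this
      exact ⟨_, app_freeMul_osmul φ _ b⟩
    change Hom Q (B i) at φ
    cases φ with
    | id =>
      obtain ⟨b, hb⟩ := (torsionSection_eq_zero_iff k r i a).1
        ((app_torsionAug k r i a).symm.trans hx)
      exact ⟨b, (mul_comm (G := k[X]) b X).trans hb.symm⟩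
    | e =>
      -- Over `A i` the coordinate `y_i` is invertible with inverse `T 1`, so multiplication by it
      -- is surjective.
      have key (a : k[T;T⁻¹]) : a * T 1 * resB k X = a := by
        rw [resB_X, mul_T_assoc, add_neg_cancel, T_zero, mul_one]
      exact ⟨_, key a⟩
  · refine ⟨0, freeCoeff.injective (Finsupp.ext fun φ => absurd ⟨φ⟩ h)⟩

theorem torsionRes_shortExact : (torsionRes k r i).ShortExact where
  exact := torsionRes_exact k r i
  mono_f := inferInstanceAs (Mono (freeMul (B i) (yB k r i)))
  epi_g := inferInstanceAs (Epi (torsionAug k r i))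

instance : Projective (torsionRes k r i).X₁ :=
  inferInstanceAs (Projective (free (sheafO k r) (B i)))

instance : Projective (torsionRes k r i).X₂ :=
  inferInstanceAs (Projective (free (sheafO k r) (B i)))

end Torsion

/-! ### Strong duality for the torsion skyscraper sheaves -/

section Duality

open C2V Polynomial LaurentPolynomial Abelian

variable (k : Type u) [Field k] (r : ℕ) (i : Fin 2)

theorem exists_eq_C_add_X_mul (p : k[X]) : ∃ (c : k) (q : k[X]), p = Polynomial.C c + X * q :=
  ⟨p.coeff 0, p.divX, by rw [add_comm, X_mul_divX_add]⟩

/-- The global section `1` of the skyscraper sheaf. -/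
def torsionOne : structureSheaf (sheafO k r) ⟶ torsionSky k r i :=
  ofSections (torsionSection k r i 1) fun _ => rfl

theorem app_torsionOne (Q : C2V) :
    app (torsionOne k r i) Q (one Q) = torsionSection k r i 1 Q :=
  app_ofSections_one (torsionSection k r i 1) (fun _ => rfl) Q

theorem torsionSky_hom_ext {f g : structureSheaf (sheafO k r) ⟶ torsionSky k r i}
    (h : app f (B i) (one (B i)) = app g (B i) (one (B i))) : f = g := by
  refine hom_ext_one fun P => ?_
  by_cases hP : P = B i
  · subst hP; exact h
  · have := subsingleton_val_torsionSky k r i hP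
    exact Subsingleton.elim _ _

theorem exists_eq_smul_torsionOne (f : structureSheaf (sheafO k r) ⟶ torsionSky k r i) :
    ∃ c : k, f = c • torsionOne k r i := by
  obtain ⟨p, hp⟩ := torsionSection_surjective k r i (app f (B i) (one (B i)))
  obtain ⟨c, q, rfl⟩ := exists_eq_C_add_X_mul k p
  refine ⟨c, torsionSky_hom_ext k r i ?_⟩
  rw [app_smul, app_torsionOne, smul_torsionSection, mul_one, ← hp]
  refine torsion_ext k r i fun _ => Ideal.Quotient.eq.2 (Ideal.mem_span_singleton.2 ⟨q, ?_⟩)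
  rw [add_sub_cancel_left]

theorem exists_eq_smul_mk₀_torsionOne (s : H 0 (torsionSky k r i)) :
    ∃ c : k, s = c • Ext.mk₀ (torsionOne k r i) := by
  obtain ⟨f, rfl⟩ := (Ext.linearEquiv₀ (R := k)).symm.surjective s
  obtain ⟨c, rfl⟩ := exists_eq_smul_torsionOne k r i f
  exact ⟨c, Ext.mk₀_smul _ _⟩

/-- `H¹` is a quotient of the sections over the `A j`, where the skyscraper sheaf is zero. -/
instance : Subsingleton (H 1 (torsionSky k r i)) := by
  have : ∀ j, Subsingleton (val (torsionSky k r i) (A j)) := fun j =>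
    subsingleton_val_torsionSky k r i (by simp)
  exact (cechClass_surjective (torsionSky k r i)).subsingleton

/-- The section `p` of `ω` over `B i`. -/
def omegaSection (p : k[X]) : val (omega k r) (B i) := p

/-- The morphism to `ω` given by `omegaSection`. -/
def omegaHom (p : k[X]) : free (sheafO k r) (B i) ⟶ omega k r :=
  (freeEquiv (B i) _).symm (omegaSection k r i p)

theorem freeMul_omegaHom (p : k[X]) :
    freeMul (B i) (yB k r i) ≫ omegaHom k r i p = omegaHom k r i (X * p) := by
  apply (freeEquiv (B i) _).injective
  rw [freeEquiv_freeMul, omegaHom, omegaHom, LinearEquiv.apply_symm_apply,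
    LinearEquiv.apply_symm_apply]
  rfl

theorem omegaHom_C_add (c : k) (p : k[X]) :
    omegaHom k r i (Polynomial.C c + p) = c • omegaHom k r i 1 + omegaHom k r i p := by
  rw [omegaHom, omegaHom, omegaHom, ← map_smul, ← map_add]
  congr 1
  change Polynomial.C c + p = Polynomial.C c * 1 + p
  rw [mul_one]

theorem omegaHom_surjective : Function.Surjective (omegaHom k r i) :=
  (freeEquiv (B i) (omega k r)).symm.surjective

theorem omegaHom_injective : Function.Injective (omegaHom k r i) :=
  (freeEquiv (B i) (omega k r)).symm.injective

/-- A morphism to `ω` gives a section over `B i` killed by `X`, and `k[X]` is a domain. -/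
instance : Subsingleton (ExtGroup (torsionSky k r i) (omega k r) 0) := by
  refine subsingleton_of_forall_eq 0 fun x => ?_
  obtain ⟨f, rfl⟩ := (Ext.linearEquiv₀ (R := k)).symm.surjective x
  suffices f = 0 by rw [this, map_zero]
  rw [← cancel_epi (torsionAug k r i), Limits.comp_zero]
  obtain ⟨p, hp⟩ := omegaHom_surjective k r i (torsionAug k r i ≫ f)
  have h₀ : omegaHom k r i 0 = 0 := (freeEquiv (B i) (omega k r)).symm.map_zero
  have h : omegaHom k r i (X * p) = omegaHom k r i 0 := by
    rw [← freeMul_omegaHom, hp, ← Category.assoc, freeMul_torsionAug, Limits.zero_comp, h₀]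
  have hp' : p = 0 := by simpa using omegaHom_injective k r i h
  rw [← hp, hp', h₀]

/-- The generator of `Ext¹(torsionSky k r i, ω)`. -/
def torsionExt : ExtGroup (torsionSky k r i) (omega k r) 1 :=
  connecting (torsionRes_shortExact k r i) k (omega k r) (omegaHom k r i 1)

/-- A section `X * q` factors through multiplication by `y_i`, so the connecting map kills it and
only the constant term counts. -/
theorem exists_eq_smul_torsionExt (x : ExtGroup (torsionSky k r i) (omega k r) 1) :
    ∃ c : k, x = c • torsionExt k r i := by
  obtain ⟨f, rfl⟩ := connecting_surjective (torsionRes_shortExact k r i) k (omega k r) x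
  obtain ⟨p, rfl⟩ := omegaHom_surjective k r i f
  obtain ⟨c, q, rfl⟩ := exists_eq_C_add_X_mul k p
  refine ⟨c, ?_⟩
  have h : connecting (torsionRes_shortExact k r i) k (omega k r) (omegaHom k r i (X * q)) = 0 :=
    (connecting_eq_zero_iff _ k _).2 ⟨omegaHom k r i q, freeMul_omegaHom k r i q⟩
  have h' := map_add (connecting (torsionRes_shortExact k r i) k (omega k r))
    (c • omegaHom k r i 1) (omegaHom k r i (X * q))
  rw [h, add_zero, map_smul] at h'
  rw [omegaHom_C_add]
  exact h'

/-- The components in degree one of the lift of `torsionOne k r i` to resolutions. -/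
def liftOneSections : ∀ j, val (free (sheafO k r) (B i)) (A j) :=
  Pi.single i
    -- `T 1` is the inverse of the restriction of `y_i`: its product with `y_i` must be the
    -- restriction of the generator over `B i`.
    (osmul (show (sheafO k r).obj (op (A i)) from (T 1 : k[T;T⁻¹])) (freeGen (e i)))

/-- The components in degree zero of the lift of `torsionOne k r i` to resolutions. -/
def liftZeroSections : ∀ j, val (free (sheafO k r) (B i)) (B j) :=
  Pi.single i (freeGen (𝟙 (B i)))

theorem freeMul_liftOneSections (j : Fin 2) :
    app (freeMul (B i) (yB k r i)) (A j) (liftOneSections k r i j) =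
      res (free (sheafO k r) (B i)) (e j) (liftZeroSections k r i j) := by
  by_cases h : j = i
  · subst h
    rw [liftOneSections, liftZeroSections, Pi.single_eq_same, Pi.single_eq_same,
      app_freeMul_osmul, res_freeGen, Category.comp_id]
    have h₁ : T 1 * resB k X = 1 := by rw [resB_X, ← T_add, add_neg_cancel, T_zero]
    refine (congrArg (fun a : k[T;T⁻¹] => osmul (show (sheafO k r).obj (op (A j)) from a)
      (freeGen (e j))) h₁).trans ?_
    exact one_osmul (freeGen (e j))
  · rw [liftOneSections, liftZeroSections, Pi.single_eq_of_ne h, Pi.single_eq_of_ne h, map_zero,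
      map_zero]

theorem torsionAug_liftZeroSections (j : Fin 2) :
    app (torsionAug k r i) (B j) (liftZeroSections k r i j) =
      app (torsionOne k r i) (B j) (one (B j)) := by
  by_cases h : j = i
  · subst h
    rw [liftZeroSections, Pi.single_eq_same, app_torsionOne, torsionAug, app_freeEquiv_symm,
      res_id]
  · have := subsingleton_val_torsionSky k r i (Q := B j) (by simpa using h)
    exact Subsingleton.elim _ _

/-- The lift of `torsionOne k r i` to resolutions. -/
def liftHom : cech (sheafO k r) ⟶ torsionRes k r i where
  τ₁ := (cechOneEquiv _).symm (liftOneSections k r i)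
  τ₂ := (cechZeroEquiv _).symm (liftZeroSections k r i, 0)
  τ₃ := torsionOne k r i
  comm₁₂ := by
    apply (cechOneEquiv _).injective
    refine Eq.trans ?_ (cechOneEquiv_cechD _).symm
    rw [cechOneEquiv_comp, LinearEquiv.apply_symm_apply, LinearEquiv.apply_symm_apply]
    funext j
    refine (freeMul_liftOneSections k r i j).trans ?_
    change _ = res (free (sheafO k r) (B i)) (e j) (liftZeroSections k r i j) -
      res (free (sheafO k r) (B i)) (e₃ j) 0
    rw [map_zero, sub_zero]
  comm₂₃ := by
    apply (cechZeroEquiv _).injective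
    refine Eq.trans ?_ (cechZeroEquiv_cechAug _).symm
    rw [cechZeroEquiv_comp, LinearEquiv.apply_symm_apply]
    have := subsingleton_val_torsionSky k r i (Q := B₃) (by simp)
    exact Prod.ext (funext fun j => torsionAug_liftZeroSections k r i j) (Subsingleton.elim _ _)

theorem omegaHom_liftOneSections (j : Fin 2) :
    app (omegaHom k r i 1) (A j) (liftOneSections k r i j) =
      omegaSingle k r i (T ((r : ℤ) - 1)) j := by
  by_cases h : j = i
  · subst h
    rw [liftOneSections, omegaSingle, Pi.single_eq_same, Pi.single_eq_same, app_osmul, omegaHom,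
      app_freeEquiv_symm]
    change (T 1 : k[T;T⁻¹]) * (T ((r : ℤ) - 2) * resB k 1) = T ((r : ℤ) - 1)
    rw [map_one, mul_one, ← T_add]
    congr 1
    ring
  · rw [liftOneSections, omegaSingle, Pi.single_eq_of_ne h, Pi.single_eq_of_ne h, map_zero]
    rfl

/-- Naturality of the extension class along `liftHom` replaces the product by the connecting map of
the Čech resolution, applied to the degree-one lift followed by `omegaHom k r i 1`. -/
theorem mk₀_torsionOne_comp_torsionExt :
    (Ext.mk₀ (torsionOne k r i)).comp (torsionExt k r i) (zero_add 1) =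
      cechClass (omega k r) (omegaSingle k r i (T ((r : ℤ) - 1))) := by
  have h := (cech_shortExact (sheafO k r)).extClass_naturality (torsionRes_shortExact k r i)
    (liftHom k r i)
  have hc : (liftHom k r i).τ₁ ≫ omegaHom k r i 1 =
      (cechOneEquiv (omega k r)).symm (omegaSingle k r i (T ((r : ℤ) - 1))) := by
    apply (cechOneEquiv _).injective
    rw [LinearEquiv.apply_symm_apply]
    refine (cechOneEquiv_comp ((cechOneEquiv _).symm (liftOneSections k r i)) _).trans ?_
    rw [LinearEquiv.apply_symm_apply]
    exact funext (omegaHom_liftOneSections k r i)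
  have h₁ : (Ext.mk₀ (torsionOne k r i)).comp (torsionExt k r i) (zero_add 1) =
      ((Ext.mk₀ (liftHom k r i).τ₃).comp (torsionRes_shortExact k r i).extClass (zero_add 1)).comp
        (Ext.mk₀ (omegaHom k r i 1)) (add_zero 1) :=
    (Ext.comp_assoc _ _ _ (zero_add 1) (add_zero 1) (by omega)).symm
  rw [h₁, ← h, Ext.comp_assoc _ _ _ (add_zero 1) (add_zero 0) (by omega), Ext.mk₀_comp_mk₀, hc]
  rfl

theorem cechClass_omegaSingle_ne_zero :
    cechClass (omega k r) (omegaSingle k r i (T ((r : ℤ) - 1))) ≠ 0 := by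
  intro h
  rw [← LinearMap.mem_ker, ker_cechClass] at h
  obtain ⟨s, hs⟩ := h
  have := residue_coboundary k r s
  rw [hs, residue_single, T_apply, if_pos rfl] at this
  -- The residue is `1` or `-1`, nonzero in any characteristic.
  fin_cases i <;> simp at this

theorem strongDuality_torsionSky (φ : H 1 (omega k r) ≃ₗ[k] k) :
    StrongDuality φ.toLinearMap (torsionSky k r i) where
  perfect_zero := by
    refine isPerfPair_of_span _ (exists_eq_smul_mk₀_torsionOne k r i)
      (exists_eq_smul_torsionExt k r i) ?_
    change φ ((Ext.mk₀ (torsionOne k r i)).comp (torsionExt k r i) (zero_add 1)) ≠ 0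
    rw [mk₀_torsionOne_comp_torsionExt]
    exact (map_ne_zero_iff φ φ.injective).2 (cechClass_omegaSingle_ne_zero k r i)
  perfect_one := isPerfPair_of_subsingleton _
  cohomology_vanishing _ hn := subsingleton_H _ hn
  ext_vanishing _ hn := subsingleton_ext_of_shortExact (torsionRes_shortExact k r i) _ hn

end Duality

end GraphRR

end

theorem mainTheorem3 (k : Type u) [Field k] (r : ℕ) (hr : 1 ≤ r) :
    Nonempty (((∀ i, GraphRR.val (GraphRR.omega k r) (GraphRR.C2V.A i)) ⧸
      LinearMap.range (GraphRR.C2V.coboundary (GraphRR.omega k r))) ≃ₗ[k] k) ∧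
    Nonempty (GraphRR.H 1 (GraphRR.omega k r) ≃ₗ[k] k) ∧
    ∀ φ : GraphRR.H 1 (GraphRR.omega k r) ≃ₗ[k] k, ∀ i : Fin 2,
      GraphRR.StrongDuality φ.toLinearMap (GraphRR.torsionSky k r i) := by
  exact ⟨⟨GraphRR.residueEquiv k r hr⟩,
    ⟨(GraphRR.C2V.quotCoboundaryEquiv (GraphRR.omega k r)).symm.trans
      (GraphRR.residueEquiv k r hr)⟩,
    fun φ i => GraphRR.strongDuality_torsionSky k r i φ⟩
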